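/- **Setup.** Let $M$ be a smooth manifold with a magnetic system $(g,\sigma)$, that is, a smooth Riemannian metric $g$ and a smooth closed $2$-form $\sigma$. Let $\nabla$ be the Levi-Civita connection of $g$, let $R(X,Y)Z=\nabla_X\nabla_YZ-\nabla_Y\nabla_XZ-\nabla_{[X,Y]}Z$ be its curvature tensor, and let $Y\colon TM\to TM$ be the Lorentz force operator, defined by $g_x(Y_x(v),w)=\sigma_x(v,w)$. For a unit vector $v\in T_xM$ let $P_v$ and $P_{v^\perp}$ be the orthogonal projections of $T_xM$ onto $\mathbb{R}v$ and $v^\perp$. For $s>0$ and $w\in v^\perp$, the $s$-magnetic curvature operator is $$(M_s)_{(x,v)}(w)=s^2R_x(w,v)v-s(\nabla_wY)_x(v)+\tfrac{s}{2}P_{v^\perp}\big((\nabla_vY)_x(w)\big)-\tfrac34 Y_x\big(P_v(Y_x(w))\big)-\tfrac14P_{v^\perp}\big(Y_x^2(w)\big),$$ and the $s$-magnetic sectional curvature of an ordered orthonormal pair $(v,w)$ in $T_xM$ is $(\mathrm{sec}^{g,\sigma}_s)_x(v,w)=g_x\big((M_s)_{(x,v)}(w),w\big)$. Let $N$ be a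 submanifold of $M$ (embedded or merely immersed), equipped with the induced magnetic system, that is, with the pullbacks of $g$ and $\sigma$ under the inclusion. For $x\in N$ and $z\in T_xM$, let $z^\perp$ be the component of $z$ orthogonal to $T_xN$. Let $\mathrm{II}(X,Z)=(\nabla^M_XZ)^\perp$ be the second fundamental form of $N$, where $\nabla^M$ is the Levi-Civita connection of $(M,g)$, let $Y^\perp_x(w)=(Y^M_x(w))^\perp$ for $w\in T_xN$, where $Y^M$ is the Lorentz force operator of $M$, and let $$(\mathrm{II}^\sigma_s)_{(x,v)}(w)=s^2\,\mathrm{II}_x(v,w)-s\,Y^\perp_x(w)$$ be the $s$-magnetic second fundamental form. **Statement.** For every $s>0$, every $x\in N$, and every orthonormal pair $(v,w)$ of vectors in $T_xN$, the $s$-magnetic sectional curvatures of $M$ and $N$ are related by $$(\mathrm{sec}^{g,\sigma}_s)^M_x(v,w)=(\mathrm{sec}^{g,\sigma}_s)^N_x(v,w)-g_x\big((\mathrm{II}^\sigma_s)_{(x,v)}(v),\mathrm{II}_x(w,w)\big)+g_x\big(\mathrm{II}_x(v,w),(\mathrm{II}^\sigma_s)_{(x,v)}(w)\big)+\tfrac14\|Y^\perp_x(w)\|^2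 .$$ -/

import Mathlib

open scoped Manifold ContDiff Bundle

noncomputable section

namespace MagneticGeometry

/-! ### Riemannian geometry in coordinates

Here `E` is a finite-dimensional real vector space, and `G : E → E →L[ℝ] E →L[ℝ] ℝ` is the
coordinate expression of a metric, defined near the point `y : E`. -/

section Coordinates

variable {E : Type*} [NormedAddCommGroup E] [NormedSpace ℝ E]

/-- The Christoffel symbols `Γ_y(u, v)` of the Levi-Civita connection, characterized by
`2 G(Γ(u, v), w) = ∂_u G(v, w) + ∂_v G(u, w) - ∂_w G(u, v)` for all `w`. The inverse of
`G y : E →L[ℝ] (E →L[ℝ] ℝ)` is the operation of raising an index. -/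
def christoffel (G : E → E →L[ℝ] E →L[ℝ] ℝ) (y u v : E) : E :=
  (G y).inverse ((1 / 2 : ℝ) •
    (fderiv ℝ G y u v + fderiv ℝ G y v u - ((fderiv ℝ G y).flip u).flip v))

/-- The curvature tensor `R(u, v)w` at `y`, for the sign convention
`R(U, V)W = ∇_U ∇_V W - ∇_V ∇_U W - ∇_[U, V] W`, computed with constant fields `U`, `V`, `W`. -/
def coordCurvature (G : E → E →L[ℝ] E →L[ℝ] ℝ) (y u v w : E) : E :=
  fderiv ℝ (fun z => christoffel G z v w) y u - fderiv ℝ (fun z => christoffel G z u w) y v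
    + christoffel G y u (christoffel G y v w) - christoffel G y v (christoffel G y u w)

/-- The covariant derivative `(∇_u A)(w)` at `y` of a field `A` of endomorphisms:
`(∇_U A)(W) = ∇_U (A W) - A (∇_U W)`, computed with constant fields `U`, `W`. -/
def coordCovDerivEnd (G : E → E →L[ℝ] E →L[ℝ] ℝ) (A : E → E →L[ℝ] E) (y u w : E) : E :=
  (fderiv ℝ (fun z => A z w) y u + christoffel G y u (A y w)) - A y (christoffel G y u w)

end Coordinates

/-! ### Tensor fields on a manifold -/

section Manifold

variable {E : Type*} [NormedAddCommGroup E] [NormedSpace ℝ E]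
  {M : Type*} [TopologicalSpace M] [ChartedSpace E M]

variable (E M) in
/-- Fields of (continuous) bilinear forms on the tangent spaces of `M`. -/
abbrev BilinField : Type _ :=
  ∀ x : M, TangentSpace 𝓘(ℝ, E) x →L[ℝ] TangentSpace 𝓘(ℝ, E) x →L[ℝ] ℝ

variable (E M) in
/-- Fields of (continuous) endomorphisms of the tangent spaces of `M`. -/
abbrev EndField : Type _ :=
  ∀ x : M, TangentSpace 𝓘(ℝ, E) x →L[ℝ] TangentSpace 𝓘(ℝ, E) x

/-- The differential at `y` of the inverse of the preferred chart at `c`. -/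
def chartSymmDeriv (c : M) (y : E) :
    E →L[ℝ] TangentSpace 𝓘(ℝ, E) ((extChartAt 𝓘(ℝ, E) c).symm y) :=
  mfderiv 𝓘(ℝ, E) 𝓘(ℝ, E) (extChartAt 𝓘(ℝ, E) c).symm y

/-- The differential, at the point with coordinates `y`, of the preferred chart at `c`. -/
def chartDeriv (c : M) (y : E) :
    TangentSpace 𝓘(ℝ, E) ((extChartAt 𝓘(ℝ, E) c).symm y) →L[ℝ] E :=
  mfderiv 𝓘(ℝ, E) 𝓘(ℝ, E) (extChartAt 𝓘(ℝ, E) c) ((extChartAt 𝓘(ℝ, E) c).symm y)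

/-- The coordinate expression of a field of bilinear forms in the preferred chart at `c`. -/
def BilinField.inChart (B : BilinField E M) (c : M) (y : E) : E →L[ℝ] E →L[ℝ] ℝ :=
  (ContinuousLinearMap.precomp ℝ (chartSymmDeriv c y)) ∘L
    (B ((extChartAt 𝓘(ℝ, E) c).symm y)) ∘L (chartSymmDeriv c y)

/-- The coordinate expression of a field of endomorphisms in the preferred chart at `c`. -/
def EndField.inChart (A : EndField E M) (c : M) (y : E) : E →L[ℝ] E :=
  (chartDeriv c y) ∘L (A ((extChartAt 𝓘(ℝ, E) c).symm y)) ∘L (chartSymmDeriv c y)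

/-- The curvature tensor `R_x(u, v)w` of the Levi-Civita connection of `g`. It is computed in the
preferred chart at `x`, whose differential at `x` is the identification of `T_x M` with `E`. -/
def curvature (g : BilinField E M) (x : M) (u v w : TangentSpace 𝓘(ℝ, E) x) :
    TangentSpace 𝓘(ℝ, E) x :=
  coordCurvature (E := E) (BilinField.inChart g x) (extChartAt 𝓘(ℝ, E) x x) u v w

/-- The covariant derivative `(∇_u A)_x(w)` of a field of endomorphisms, for the Levi-Civita
connection `∇` of `g`. -/
def covDerivEnd (g : BilinField E M) (A : EndField E M) (x : M)
    (u w : TangentSpace 𝓘(ℝ, E) x) : TangentSpace 𝓘(ℝ, E) x :=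
  coordCovDerivEnd (E := E) (BilinField.inChart g x) (EndField.inChart A x) (extChartAt 𝓘(ℝ, E) x x) u w

/-! ### Magnetic curvature -/

/-- The Lorentz force operator `Y`, characterized by `g(Y v, w) = σ(v, w)`. -/
def lorentz (g σ : BilinField E M) : EndField E M :=
  fun x => (g x).inverse ∘L (σ x)

/-- The orthogonal projection `P_v` of `T_x M` onto the line spanned by `v`. -/
def projLine (g : BilinField E M) (x : M) (v z : TangentSpace 𝓘(ℝ, E) x) :
    TangentSpace 𝓘(ℝ, E) x :=
  (g x z v / g x v v) • v

/-- The orthogonal projection of `T_x M` onto the hyperplane `v^⊥`. -/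
def projPerp (g : BilinField E M) (x : M) (v z : TangentSpace 𝓘(ℝ, E) x) :
    TangentSpace 𝓘(ℝ, E) x :=
  z - projLine g x v z

/-- The operator `A_{(x, v)}(w) = -3/4 Y(P_v(Y w)) - 1/4 P_{v^⊥}(Y² w)`. -/
def magA (g σ : BilinField E M) (x : M) (v w : TangentSpace 𝓘(ℝ, E) x) :
    TangentSpace 𝓘(ℝ, E) x :=
  -((3 / 4 : ℝ) • lorentz g σ x (projLine g x v (lorentz g σ x w)))
    - (1 / 4 : ℝ) • projPerp g x v (lorentz g σ x (lorentz g σ x w))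

/-- The operator
`(R_s)_{(x, v)}(w) = s² R(w, v)v - s (∇_w Y)(v) + s/2 P_{v^⊥}((∇_v Y)(w))`. -/
def magR (g σ : BilinField E M) (s : ℝ) (x : M) (v w : TangentSpace 𝓘(ℝ, E) x) :
    TangentSpace 𝓘(ℝ, E) x :=
  s ^ 2 • curvature g x w v v - s • covDerivEnd g (lorentz g σ) x w v
    + (s / 2) • projPerp g x v (covDerivEnd g (lorentz g σ) x v w)

/-- The `s`-magnetic curvature operator `(M_s)_{(x, v)}(w)`. -/
def magCurvature (g σ : BilinField E M) (s : ℝ) (x : M) (v w : TangentSpace 𝓘(ℝ, E) x) :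
    TangentSpace 𝓘(ℝ, E) x :=
  magR g σ s x v w + magA g σ x v w

/-- The `s`-magnetic sectional curvature `(sec_s)_x(v, w)`, meant for orthonormal `v`, `w`. -/
def magSec (g σ : BilinField E M) (s : ℝ) (x : M) (v w : TangentSpace 𝓘(ℝ, E) x) : ℝ :=
  g x (magCurvature g σ s x v w) w

/-- A two-form is closed if its exterior derivative vanishes in every chart:
`∂_u σ(v, w) + ∂_v σ(w, u) + ∂_w σ(u, v) = 0`. -/
def IsClosedForm (σ : BilinField E M) : Prop :=
  ∀ c : M, ∀ y ∈ (extChartAt 𝓘(ℝ, E) c).target, ∀ u v w : E,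
    fderiv ℝ (BilinField.inChart σ c) y u v w + fderiv ℝ (BilinField.inChart σ c) y v w u
      + fderiv ℝ (BilinField.inChart σ c) y w u v = 0

variable (E M) in
/-- A magnetic system on `M`: a smooth Riemannian metric together with a smooth closed two-form. -/
structure MagneticSystem [IsManifold 𝓘(ℝ, E) ∞ M] where
  /-- The Riemannian metric. -/
  metric : Bundle.ContMDiffRiemannianMetric 𝓘(ℝ, E) ∞ E
    (fun x : M => TangentSpace 𝓘(ℝ, E) x)
  /-- The magnetic form. -/
  form : BilinField E M
  form_self (x : M) (v : TangentSpace 𝓘(ℝ, E) x) : form x v v = 0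
  form_contMDiff : ContMDiff 𝓘(ℝ, E) (𝓘(ℝ, E).prod 𝓘(ℝ, E →L[ℝ] E →L[ℝ] ℝ)) ∞
    (fun x : M => Bundle.TotalSpace.mk' (E →L[ℝ] E →L[ℝ] ℝ)
      (E := fun x : M => TangentSpace 𝓘(ℝ, E) x →L[ℝ] TangentSpace 𝓘(ℝ, E) x →L[ℝ] ℝ)
      x (form x))
  form_closed : IsClosedForm form

end Manifold

/-! ### Submanifolds

A submanifold is given by its inclusion `ι : N → M`. -/

section Submanifold

variable {E : Type*} [NormedAddCommGroup E] [NormedSpace ℝ E]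
  {M : Type*} [TopologicalSpace M] [ChartedSpace E M]
  {F : Type*} [NormedAddCommGroup F] [NormedSpace ℝ F]
  {N : Type*} [TopologicalSpace N] [ChartedSpace F N]

/-- The differential `T_x N → T_{ι x} M` of `ι`. -/
def differential (ι : N → M) (x : N) :
    TangentSpace 𝓘(ℝ, F) x →L[ℝ] TangentSpace 𝓘(ℝ, E) (ι x) :=
  mfderiv 𝓘(ℝ, F) 𝓘(ℝ, E) ι x

/-- The field of bilinear forms on `N` induced from one on `M` by pullback. -/
def induced (ι : N → M) (B : BilinField E M) : BilinField F N :=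
  fun x => (ContinuousLinearMap.precomp ℝ (differential ι x)) ∘L
    (B (ι x)) ∘L (differential ι x)

/-- The tangential projection `z^⊤ ∈ T_x N` of `z ∈ T_{ι x} M`, characterized by
`(ι^*g)(z^⊤, u) = g(z, dι u)` for all `u ∈ T_x N`. -/
def tangentPart (ι : N → M) (g : BilinField E M) (x : N) (z : TangentSpace 𝓘(ℝ, E) (ι x)) :
    TangentSpace 𝓘(ℝ, F) x :=
  (induced ι g x).inverse ((g (ι x) z) ∘L (differential ι x))

/-- The normal projection `z^⊥ = z - z^⊤` of `z ∈ T_{ι x} M`. -/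
def normalPart (ι : N → M) (g : BilinField E M) (x : N) (z : TangentSpace 𝓘(ℝ, E) (ι x)) :
    TangentSpace 𝓘(ℝ, E) (ι x) :=
  z - differential ι x (tangentPart (F := F) ι g x z)

/-- The derivative `∇_v W` at `x`, for the Levi-Civita connection `∇` of `g` on `M`, of the vector
field `W` tangent to `N` which has value `w` at `x` and is constant in the preferred chart of `N`
at `x`. In coordinates `W` is `y ↦ Dι(y) w`. -/
def ambientCovDeriv (ι : N → M) (g : BilinField E M) (x : N) (v w : TangentSpace 𝓘(ℝ, F) x) :
    TangentSpace 𝓘(ℝ, E) (ι x) :=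
  (fderiv ℝ (fun y : F => fderiv ℝ (writtenInExtChartAt 𝓘(ℝ, F) 𝓘(ℝ, E) x ι) y w)
      (extChartAt 𝓘(ℝ, F) x x) v : E)
    + christoffel (BilinField.inChart g (ι x)) (extChartAt 𝓘(ℝ, E) (ι x) (ι x))
        (differential ι x v) (differential ι x w)

/-- The second fundamental form `II_x(v, w)`, the normal component of `∇_v W`. -/
def secondFundForm (ι : N → M) (g : BilinField E M) (x : N) (v w : TangentSpace 𝓘(ℝ, F) x) :
    TangentSpace 𝓘(ℝ, E) (ι x) :=
  normalPart (F := F) ι g x (ambientCovDeriv ι g x v w)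

/-- The normal Lorentz force `Y^⊥_x(v) = (Y_x v)^⊥`, for `v ∈ T_x N`. -/
def normalLorentz (ι : N → M) (g σ : BilinField E M) (x : N) (v : TangentSpace 𝓘(ℝ, F) x) :
    TangentSpace 𝓘(ℝ, E) (ι x) :=
  normalPart (F := F) ι g x (lorentz g σ (ι x) (differential ι x v))

/-- The `s`-magnetic second fundamental form `(II_s)_{(x, v)}(w) = s² II_x(v, w) - s Y^⊥_x(w)`. -/
def magSecondFundForm (ι : N → M) (g σ : BilinField E M) (s : ℝ) (x : N)
    (v w : TangentSpace 𝓘(ℝ, F) x) : TangentSpace 𝓘(ℝ, E) (ι x) :=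
  s ^ 2 • secondFundForm ι g x v w - s • normalLorentz ι g σ x w

end Submanifold

end MagneticGeometry

end

noncomputable section

open scoped Topology

namespace MagneticGeometry

/-! ### Riemannian geometry of a metric on an open part of a vector space. -/

section Coordinates

set_option maxSynthPendingDepth 3

variable {E : Type*} [NormedAddCommGroup E] [NormedSpace ℝ E]
  {F : Type*} [NormedAddCommGroup F] [NormedSpace ℝ F]

/-! For orthonormal v, w the magnetic sectional curvature equals (`magSec_eq`) s² g(R(w,v)v, w) - s
g((∇_w Y)v, w) + (s/2) g((∇_v Y)w, w) + (3/4) σ(v,w)² + (1/4) |Yw|², and each summand is compared on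
`M` and on `N`.

The curvature term changes by the Gauss equation (`gauss_equation`). For the terms in ∇Y, lowering
an index gives g((∇_u Y)w, z) = (∇_u σ)(w, z). Since the connection of `N` is the tangential part of
that of `M`, the two versions of (∇_u σ)(w, z) differ only by values of σ on a normal vector II and
a tangent vector, that is, by pairings of II with Y^⊥ (`metric_covDerivEnd_lorentz`). This gives the
corrections linear in s from (∇_w Y)v; those from g((∇_v Y)w, w) cancel. The number σ(v,w) is
unchanged, and Yw splits orthogonally into the Lorentz force of `N` and Y^⊥w, which leaves (1/4)
|Y^⊥w|².

The geometry is done in charts, where the inclusion becomes an immersion f of vector spaces. The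
central object is the covariant Hessian H(v,w) = D²f(v,w) + Γ(Df v, Df w). Its tangential part is
the Christoffel symbol of the pulled-back metric (`pullback_christoffel`), its normal part is II,
and antisymmetrizing its covariant derivative gives the ambient curvature
(`covAlong_covHessian_sub`). Differentiating the tangential relation then yields the Gauss equation.
-/

/-- `G` is smooth at `p`, and its value there is an inner product. -/
structure IsMetricAt (G : E → E →L[ℝ] E →L[ℝ] ℝ) (p : E) : Prop where
  contDiffAt : ContDiffAt ℝ ∞ G p
  symm : ∀ u v, G p u v = G p v u
  pos : ∀ u, u ≠ 0 → 0 < G p u u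

/-- `ContinuousLinearMap.inverse` is zero on non-invertible maps, so every use of raising an index
rests on this fact. Positivity gives injectivity, and a space has the same dimension as its dual. -/
theorem isInvertible_of_pos [FiniteDimensional ℝ E] {B : E →L[ℝ] E →L[ℝ] ℝ}
    (hB : ∀ u, u ≠ 0 → 0 < B u u) : B.IsInvertible := by
  have hinj : Function.Injective (B : E →ₗ[ℝ] E →L[ℝ] ℝ) := by
    rw [← LinearMap.ker_eq_bot, LinearMap.ker_eq_bot']
    intro u hu
    by_contra hne
    have h := hB u hne
    have h' : B u = 0 := hu
    simp [h'] at h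
  have hdim : Module.finrank ℝ E = Module.finrank ℝ (E →L[ℝ] ℝ) := by
    rw [← LinearEquiv.finrank_eq (LinearMap.toContinuousLinearMap (𝕜 := ℝ) (E := E) (F' := ℝ))]
    exact Subspace.dual_finrank_eq.symm
  exact ⟨(LinearEquiv.ofInjectiveOfFinrankEq (B : E →ₗ[ℝ] E →L[ℝ] ℝ) hinj hdim).toContinuousLinearEquiv,
    by ext; rfl⟩

theorem eq_of_forall_apply_eq {B : E →L[ℝ] E →L[ℝ] ℝ} (hB : ∀ u, u ≠ 0 → 0 < B u u) {a b : E}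
    (h : ∀ w, B a w = B b w) : a = b := by
  by_contra hne
  have h1 := hB (a - b) (sub_ne_zero.mpr hne)
  have h2 := h (a - b)
  simp only [map_sub, sub_apply] at h1 h2
  linarith

variable {G : E → E →L[ℝ] E →L[ℝ] ℝ} {p : E}

theorem fderiv_apply_apply {B : F → E →L[ℝ] E →L[ℝ] ℝ} {y : F} (hB : DifferentiableAt ℝ B y)
    (u : F) (v w : E) : fderiv ℝ (fun z => B z v w) y u = fderiv ℝ B y u v w := by
  have h := ((hB.hasFDerivAt.clm_apply (hasFDerivAt_const v y)).clm_apply (hasFDerivAt_const w y))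
  rw [h.fderiv]
  simp

theorem fderiv_symm_of_eventually (h : ∀ᶠ z in 𝓝 p, IsMetricAt G z) (u v w : E) :
    fderiv ℝ G p u v w = fderiv ℝ G p u w v := by
  have hd := h.self_of_nhds.contDiffAt.differentiableAt (by simp)
  rw [← fderiv_apply_apply hd, ← fderiv_apply_apply hd]
  congr 1
  exact Filter.EventuallyEq.fderiv_eq (h.mono fun z hz => hz.symm v w)

theorem christoffel_symm (h : ∀ᶠ z in 𝓝 p, IsMetricAt G z) (u v : E) :
    christoffel G p u v = christoffel G p v u := by
  unfold christoffel
  congr 2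
  ext w
  simp only [sub_apply, add_apply,
    ContinuousLinearMap.flip_apply]
  rw [fderiv_symm_of_eventually h w u v]
  ring

theorem metric_christoffel [FiniteDimensional ℝ E] (h : IsMetricAt G p) (u v w : E) :
    G p (christoffel G p u v) w =
      (1 / 2) * (fderiv ℝ G p u v w + fderiv ℝ G p v u w - fderiv ℝ G p w u v) := by
  unfold christoffel
  rw [(isInvertible_of_pos h.pos).self_apply_inverse]
  simp

/-- Metric compatibility, ∇G = 0: in the sum of the two Koszul formulas all but one derivative
cancel. -/
theorem fderiv_metric [FiniteDimensional ℝ E] (h : ∀ᶠ z in 𝓝 p, IsMetricAt G z) (u v w : E) :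
    fderiv ℝ G p u v w = G p (christoffel G p u v) w + G p v (christoffel G p u w) := by
  rw [h.self_of_nhds.symm v, metric_christoffel h.self_of_nhds, metric_christoffel h.self_of_nhds,
    fderiv_symm_of_eventually h u w v, fderiv_symm_of_eventually h v u w,
    fderiv_symm_of_eventually h w u v]
  ring

/-- The Christoffel symbols with the last index lowered, as a trilinear map. -/
def loweredChristoffelL (G : E → E →L[ℝ] E →L[ℝ] ℝ) (y : E) : E →L[ℝ] E →L[ℝ] E →L[ℝ] ℝ :=
  (1 / 2 : ℝ) • (fderiv ℝ G y + (fderiv ℝ G y).flip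
    - (ContinuousLinearMap.flipₗᵢ ℝ E E ℝ).toContinuousLinearEquiv.toContinuousLinearMap ∘L (fderiv ℝ G y).flip)

/-- The Christoffel symbols as a bilinear map. -/
def christoffelL (G : E → E →L[ℝ] E →L[ℝ] ℝ) (y : E) : E →L[ℝ] E →L[ℝ] E :=
  (ContinuousLinearMap.compL ℝ E (E →L[ℝ] ℝ) E (G y).inverse) ∘L loweredChristoffelL G y

theorem christoffelL_apply (y u v : E) : christoffelL G y u v = christoffel G y u v := by
  rfl

theorem contDiffAt_inverse [FiniteDimensional ℝ E] {G : F → E →L[ℝ] E →L[ℝ] ℝ} {p : F}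
    (h : ContDiffAt ℝ ∞ G p) (hpos : ∀ u, u ≠ 0 → 0 < G p u u) :
    ContDiffAt ℝ ∞ (fun z => (G z).inverse) p := by
  have : CompleteSpace E := FiniteDimensional.complete ℝ E
  exact ((isInvertible_of_pos hpos).contDiffAt_map_inverse).comp p h

-- The bundled form `christoffelL` takes values in a fixed normed space of bilinear maps, so
-- smoothness and the chain rule apply to it as a single function of the base point.
set_option synthInstance.maxHeartbeats 200000 in
theorem contDiffAt_christoffelL [FiniteDimensional ℝ E] (h : IsMetricAt G p) :
    ContDiffAt ℝ ∞ (christoffelL G) p := by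
  have hG := contDiffAt_inverse h.contDiffAt h.pos
  have hD : ContDiffAt ℝ ∞ (fderiv ℝ G) p := h.contDiffAt.fderiv_right (by simp)
  have hflip : ContDiffAt ℝ ∞ (fun y => (fderiv ℝ G y).flip) p :=
    (ContinuousLinearMap.flipₗᵢ ℝ E E (E →L[ℝ] ℝ)).contDiff.contDiffAt.comp p hD
  have hL : ContDiffAt ℝ ∞ (loweredChristoffelL G) p :=
    ((hD.add hflip).sub (contDiffAt_const.clm_comp hflip)).const_smul _
  exact ((ContinuousLinearMap.compL ℝ E (E →L[ℝ] ℝ) E).contDiff.contDiffAt.comp p hG).clm_comp hL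

theorem fderiv_christoffel [FiniteDimensional ℝ E] (h : IsMetricAt G p) (u v w : E) :
    fderiv ℝ (fun z => christoffel G z v w) p u = fderiv ℝ (christoffelL G) p u v w := by
  have hd := ((contDiffAt_christoffelL h).differentiableAt (by simp)).hasFDerivAt
  have h' := ((hd.clm_apply (hasFDerivAt_const v p)).clm_apply (hasFDerivAt_const w p)).fderiv
  simp only [christoffelL_apply] at h'
  rw [h']
  simp

/-! ### Covariant differentiation along a map, and pullback of forms. -/

/-- The covariant derivative `∇_u X` at `y` of a vector field `X` along `f`. -/
def covAlong (G : E → E →L[ℝ] E →L[ℝ] ℝ) (f : F → E) (y u : F) (X : F → E) : E :=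
  fderiv ℝ X y u + christoffel G (f y) (fderiv ℝ f y u) (X y)

theorem fderiv_form_along {B : E → E →L[ℝ] E →L[ℝ] ℝ} {f X Z : F → E} {y : F}
    (hB : DifferentiableAt ℝ B (f y)) (hf : DifferentiableAt ℝ f y)
    (hX : DifferentiableAt ℝ X y) (hZ : DifferentiableAt ℝ Z y) (u : F) :
    fderiv ℝ (fun z => B (f z) (X z) (Z z)) y u =
      fderiv ℝ B (f y) (fderiv ℝ f y u) (X y) (Z y) + B (f y) (fderiv ℝ X y u) (Z y)
        + B (f y) (X y) (fderiv ℝ Z y u) := by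
  have hBf : HasFDerivAt (fun z => B (f z)) _ y := hB.hasFDerivAt.comp y hf.hasFDerivAt
  rw [((hBf.clm_apply hX.hasFDerivAt).clm_apply hZ.hasFDerivAt).fderiv]
  simp
  ring

theorem fderiv_metric_along [FiniteDimensional ℝ E] {f X Z : F → E} {y : F}
    (hG : ∀ᶠ z in 𝓝 (f y), IsMetricAt G z) (hf : DifferentiableAt ℝ f y)
    (hX : DifferentiableAt ℝ X y) (hZ : DifferentiableAt ℝ Z y) (u : F) :
    fderiv ℝ (fun z => G (f z) (X z) (Z z)) y u =
      G (f y) (covAlong G f y u X) (Z y) + G (f y) (X y) (covAlong G f y u Z) := by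
  rw [fderiv_form_along (hG.self_of_nhds.contDiffAt.differentiableAt (by simp)) hf hX hZ,
    fderiv_metric hG]
  simp only [covAlong, map_add, add_apply]
  ring

/-- The pullback of a field of bilinear forms. -/
def pullbackForm (f : F → E) (B : E → E →L[ℝ] E →L[ℝ] ℝ) (y : F) : F →L[ℝ] F →L[ℝ] ℝ :=
  (ContinuousLinearMap.precomp ℝ (fderiv ℝ f y)) ∘L (B (f y)) ∘L (fderiv ℝ f y)

theorem pullbackForm_apply (f : F → E) (B : E → E →L[ℝ] E →L[ℝ] ℝ) (y u v : F) :
    pullbackForm f B y u v = B (f y) (fderiv ℝ f y u) (fderiv ℝ f y v) := rfl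

theorem contDiffAt_pullbackForm {f : F → E} {B : E → E →L[ℝ] E →L[ℝ] ℝ} {y : F}
    (hf : ContDiffAt ℝ ∞ f y) (hB : ContDiffAt ℝ ∞ B (f y)) :
    ContDiffAt ℝ ∞ (pullbackForm f B) y := by
  have hD : ContDiffAt ℝ ∞ (fderiv ℝ f) y := hf.fderiv_right (by simp)
  have hp : ContDiffAt ℝ ∞ (fun z => ContinuousLinearMap.precomp ℝ (fderiv ℝ f z)) y :=
    ((ContinuousLinearMap.compL ℝ F E ℝ).flip).contDiff.contDiffAt.comp y hD
  exact hp.clm_comp ((hB.comp y hf).clm_comp hD)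

/-- `f` is smooth at `y`, with injective differential. -/
structure IsImmersedAt (f : F → E) (y : F) : Prop where
  contDiffAt : ContDiffAt ℝ ∞ f y
  injective : Function.Injective (fderiv ℝ f y)

theorem IsMetricAt.pullback {f : F → E} {y : F} (hf : IsImmersedAt f y)
    (h : IsMetricAt G (f y)) : IsMetricAt (pullbackForm f G) y where
  contDiffAt := contDiffAt_pullbackForm hf.contDiffAt h.contDiffAt
  symm _ _ := h.symm _ _
  pos _ hu := h.pos _ fun h0 => hu (hf.injective (h0.trans (map_zero _).symm))

/-! ### The covariant Hessian of an immersion and the Gauss equation. -/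

section Immersion

variable {f : F → E} {y : F}

theorem differentiableAt_fderiv_apply (hf : ContDiffAt ℝ ∞ f y) (w : F) :
    DifferentiableAt ℝ (fun z => fderiv ℝ f z w) y :=
  ((hf.fderiv_right (m := ∞) (by simp)).differentiableAt (by simp)).clm_apply
    (differentiableAt_const w)

theorem fderiv_fderiv_apply (hf : ContDiffAt ℝ ∞ f y) (v w : F) :
    fderiv ℝ (fun z => fderiv ℝ f z w) y v = fderiv ℝ (fderiv ℝ f) y v w := by
  have hd := ((hf.fderiv_right (m := ∞) (by simp)).differentiableAt (by simp)).hasFDerivAt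
  rw [(hd.clm_apply (hasFDerivAt_const w y)).fderiv]
  simp

theorem fderiv_fderiv_symm (hf : ContDiffAt ℝ ∞ f y) (v w : F) :
    fderiv ℝ (fderiv ℝ f) y v w = fderiv ℝ (fderiv ℝ f) y w v :=
  (hf.isSymmSndFDerivAt (by rw [minSmoothness_of_isRCLikeNormedField]; exact WithTop.coe_le_coe.2 le_top)) v w

/-- The covariant derivative, along `f`, of the image under `f` of a constant field. -/
def covHessian (G : E → E →L[ℝ] E →L[ℝ] ℝ) (f : F → E) (y v w : F) : E :=
  covAlong G f y v (fun z => fderiv ℝ f z w)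

theorem covHessian_eq (hf : ContDiffAt ℝ ∞ f y) (v w : F) : covHessian G f y v w =
    fderiv ℝ (fderiv ℝ f) y v w + christoffelL G (f y) (fderiv ℝ f y v) (fderiv ℝ f y w) := by
  rw [covHessian, covAlong, fderiv_fderiv_apply hf]
  rfl

theorem covHessian_symm (hf : ContDiffAt ℝ ∞ f y) (hG : ∀ᶠ z in 𝓝 (f y), IsMetricAt G z)
    (v w : F) : covHessian G f y v w = covHessian G f y w v := by
  rw [covHessian_eq hf, covHessian_eq hf, fderiv_fderiv_symm hf, christoffelL_apply,
    christoffel_symm hG, christoffelL_apply]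

/-- The Koszul formula for the pulled-back metric: by compatibility along `f`, each of its three
derivatives is a sum of two products of H with Df, and symmetry of H cancels all but one pair. Hence
the tangential part of H is the intrinsic connection. -/
theorem pullback_christoffel [FiniteDimensional ℝ E] [FiniteDimensional ℝ F]
    (hf : IsImmersedAt f y) (hG : ∀ᶠ z in 𝓝 (f y), IsMetricAt G z) (u v w : F) :
    pullbackForm f G y (christoffel (pullbackForm f G) y u v) w =
      G (f y) (covHessian G f y u v) (fderiv ℝ f y w) := by
  have hH := hG.self_of_nhds.pullback hf
  have hd := hH.contDiffAt.differentiableAt (by simp)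
  have key (a b c : F) : fderiv ℝ (pullbackForm f G) y a b c =
      G (f y) (covHessian G f y a b) (fderiv ℝ f y c)
        + G (f y) (covHessian G f y a c) (fderiv ℝ f y b) := by
    rw [← fderiv_apply_apply hd]
    simp only [pullbackForm_apply]
    rw [fderiv_metric_along hG (hf.contDiffAt.differentiableAt (by simp))
      (differentiableAt_fderiv_apply hf.contDiffAt b)
      (differentiableAt_fderiv_apply hf.contDiffAt c), hG.self_of_nhds.symm (fderiv ℝ f y b)]
    rfl
  rw [metric_christoffel hH, key, key, key, covHessian_symm hf.contDiffAt hG v u,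
    covHessian_symm hf.contDiffAt hG w u, covHessian_symm hf.contDiffAt hG w v]
  ring

theorem hasFDerivAt_covHessian [FiniteDimensional ℝ E] (hf : ∀ᶠ z in 𝓝 y, ContDiffAt ℝ ∞ f z)
    (hG : IsMetricAt G (f y)) (v w : F) : ∃ L : F →L[ℝ] E,
    HasFDerivAt (fun z => covHessian G f z v w) L y ∧ ∀ u, L u =
      fderiv ℝ (fderiv ℝ (fderiv ℝ f)) y u v w
      + (fderiv ℝ (christoffelL G) (f y) (fderiv ℝ f y u) (fderiv ℝ f y v) (fderiv ℝ f y w)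
        + christoffelL G (f y) (fderiv ℝ (fderiv ℝ f) y u v) (fderiv ℝ f y w)
        + christoffelL G (f y) (fderiv ℝ f y v) (fderiv ℝ (fderiv ℝ f) y u w)) := by
  have hf0 := hf.self_of_nhds
  have h1 : ContDiffAt ℝ ∞ (fderiv ℝ f) y := hf0.fderiv_right (by simp)
  have h2 : ContDiffAt ℝ ∞ (fderiv ℝ (fderiv ℝ f)) y := h1.fderiv_right (by simp)
  have d0 := (hf0.differentiableAt (by simp)).hasFDerivAt
  have d1 := (h1.differentiableAt (by simp)).hasFDerivAt
  have d2 := (h2.differentiableAt (by simp)).hasFDerivAt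
  have dΓ := ((contDiffAt_christoffelL hG).differentiableAt (by simp)).hasFDerivAt
  have dΓf : HasFDerivAt (fun z => christoffelL G (f z)) _ y := dΓ.comp y d0
  have dd (w : F) := d1.clm_apply (hasFDerivAt_const w y)
  have hsum := (((d2.clm_apply (hasFDerivAt_const v y)).clm_apply (hasFDerivAt_const w y))).add
    ((dΓf.clm_apply (dd v)).clm_apply (dd w))
  refine ⟨_, hsum.congr_of_eventuallyEq (hf.mono fun z hz => covHessian_eq hz v w), fun u => ?_⟩
  simp
  abel

/-- The fields Df u and Df v come from commuting constant fields, so the commutator of covariant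
derivatives along `f` is pure curvature. In formulas, the second and third derivatives of `f` drop
out by symmetry, leaving the derivatives of Γ and its quadratic terms. -/
theorem covAlong_covHessian_sub [FiniteDimensional ℝ E] (hf : ∀ᶠ z in 𝓝 y, ContDiffAt ℝ ∞ f z)
    (hG : ∀ᶠ z in 𝓝 (f y), IsMetricAt G z) (u v w : F) :
    covAlong G f y u (fun z => covHessian G f z v w)
      - covAlong G f y v (fun z => covHessian G f z u w) =
    coordCurvature G (f y) (fderiv ℝ f y u) (fderiv ℝ f y v) (fderiv ℝ f y w) := by
  have hf0 := hf.self_of_nhds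
  have hG0 := hG.self_of_nhds
  have h1 : ContDiffAt ℝ ∞ (fderiv ℝ f) y := hf0.fderiv_right (by simp)
  obtain ⟨L, hL, hL'⟩ := hasFDerivAt_covHessian hf hG0 v w
  obtain ⟨K, hK, hK'⟩ := hasFDerivAt_covHessian hf hG0 u w
  rw [covAlong, covAlong, hL.fderiv, hK.fderiv, hL', hK', coordCurvature,
    fderiv_christoffel hG0, fderiv_christoffel hG0, covHessian_eq hf0, covHessian_eq hf0,
    fderiv_fderiv_symm hf0 v u, fderiv_fderiv_symm h1 v u]
  simp only [← christoffelL_apply, map_add]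
  abel

/-- The Gauss equation in coordinates. -/
theorem coord_gauss [FiniteDimensional ℝ E] [FiniteDimensional ℝ F]
    (hf : ∀ᶠ z in 𝓝 y, IsImmersedAt f z) (hG : ∀ᶠ z in 𝓝 (f y), IsMetricAt G z)
    (u v w z : F) :
    G (f y) (coordCurvature G (f y) (fderiv ℝ f y u) (fderiv ℝ f y v) (fderiv ℝ f y w))
        (fderiv ℝ f y z) =
      pullbackForm f G y (coordCurvature (pullbackForm f G) y u v w) z
      + (pullbackForm f G y (christoffel (pullbackForm f G) y v w)
            (christoffel (pullbackForm f G) y u z)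
          - G (f y) (covHessian G f y v w) (covHessian G f y u z))
      - (pullbackForm f G y (christoffel (pullbackForm f G) y u w)
            (christoffel (pullbackForm f G) y v z)
          - G (f y) (covHessian G f y u w) (covHessian G f y v z)) := by
  have hf0 := hf.self_of_nhds
  have hG0 := hG.self_of_nhds
  have hfc : ∀ᶠ z in 𝓝 y, ContDiffAt ℝ ∞ f z := hf.mono fun z hz => hz.contDiffAt
  have hfG : ∀ᶠ z in 𝓝 y, ∀ᶠ q in 𝓝 (f z), IsMetricAt G q :=
    hf0.contDiffAt.continuousAt.eventually hG.eventually_nhds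
  have hH : ∀ᶠ z in 𝓝 y, IsMetricAt (pullbackForm f G) z := by
    filter_upwards [hf, hfG] with z h1 h2 using h2.self_of_nhds.pullback h1
  have hH0 := hH.self_of_nhds
  -- Differentiate G(H(v,w), Df z) = (f^*G)(Γ(v,w), z) in the direction u, using metric
  -- compatibility on both sides. The derivative of Df z is H(u,z), whence the product
  -- H(v,w)·H(u,z); antisymmetrizing in u, v finishes the proof.
  have half (u v : F) : G (f y) (covAlong G f y u (fun z => covHessian G f z v w))
      (fderiv ℝ f y z) =
      pullbackForm f G y (fderiv ℝ (fun z => christoffel (pullbackForm f G) z v w) y u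
        + christoffel (pullbackForm f G) y u (christoffel (pullbackForm f G) y v w)) z
      + (pullbackForm f G y (christoffel (pullbackForm f G) y v w)
            (christoffel (pullbackForm f G) y u z)
          - G (f y) (covHessian G f y v w) (covHessian G f y u z)) := by
    obtain ⟨L, hL, -⟩ := hasFDerivAt_covHessian hfc hG0 v w
    have e1 := fderiv_metric_along hG (hf0.contDiffAt.differentiableAt (by simp))
      hL.differentiableAt (differentiableAt_fderiv_apply hf0.contDiffAt z) u
    have hΓ : DifferentiableAt ℝ (fun z => christoffel (pullbackForm f G) z v w) y :=
      (((contDiffAt_christoffelL hH0).differentiableAt (by simp)).clm_apply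
        (differentiableAt_const v)).clm_apply (differentiableAt_const w)
    have e2 := fderiv_form_along (f := fun z : F => z) (Z := fun _ => z)
      (hH0.contDiffAt.differentiableAt (by simp)) differentiableAt_id hΓ
      (differentiableAt_const z) u
    have e3 : (fun q => G (f q) (covHessian G f q v w) (fderiv ℝ f q z)) =ᶠ[𝓝 y]
        fun q => pullbackForm f G q (christoffel (pullbackForm f G) q v w) z := by
      filter_upwards [hf, hfG] with q h1 h2 using (pullback_christoffel h1 h2 v w z).symm
    rw [e3.fderiv_eq, e2, fderiv_metric hH] at e1
    simp only [fderiv_fun_id, fderiv_fun_const, ContinuousLinearMap.coe_id', id_eq, Pi.zero_apply,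
      zero_apply, map_zero, add_zero] at e1
    rw [map_add, add_apply]
    change _ = _ + G (f y) _ (covHessian G f y u z) at e1
    linarith
  rw [← covAlong_covHessian_sub hfc hG, map_sub, sub_apply, half, half,
    coordCurvature]
  simp only [map_sub, map_add, sub_apply, add_apply]
  ring

end Immersion

/-! ### The covariant derivative of the Lorentz force in coordinates. -/

theorem metric_coordCovDerivEnd_lorentz [FiniteDimensional ℝ E] {B : E → E →L[ℝ] E →L[ℝ] ℝ}
    (hG : ∀ᶠ z in 𝓝 p, IsMetricAt G z) (hB : ContDiffAt ℝ ∞ B p) (u w z : E) :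
    G p (coordCovDerivEnd G (fun q => (G q).inverse ∘L B q) p u w) z =
      fderiv ℝ B p u w z - B p (christoffel G p u w) z - B p w (christoffel G p u z) := by
  have hG0 := hG.self_of_nhds
  have hY : DifferentiableAt ℝ (fun q => ((G q).inverse ∘L B q) w) p :=
    (((contDiffAt_inverse hG0.contDiffAt hG0.pos).clm_comp hB).differentiableAt (by simp)).clm_apply
      (differentiableAt_const w)
  have hlow {q : E} (hq : IsMetricAt G q) (a b : E) :
      G q (((G q).inverse ∘L B q) a) b = B q a b := by
    rw [ContinuousLinearMap.comp_apply, (isInvertible_of_pos hq.pos).self_apply_inverse]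
  have e1 := fderiv_form_along (f := fun z : E => z) (Z := fun _ => z)
    (hG0.contDiffAt.differentiableAt (by simp)) differentiableAt_id hY
    (differentiableAt_const z) u
  -- Lowering the index turns the endomorphism into `B` near `p`. Differentiating this relation,
  -- with ∇G = 0, identifies the lowered ∇Y with ∇B.
  have e3 : (fun q => G q (((G q).inverse ∘L B q) w) z) =ᶠ[𝓝 p] fun q => B q w z :=
    hG.mono fun q hq => hlow hq w z
  rw [e3.fderiv_eq, fderiv_apply_apply (hB.differentiableAt (by simp)), fderiv_metric hG,
    hlow hG0] at e1
  simp only [fderiv_fun_id, fderiv_fun_const, ContinuousLinearMap.coe_id', id_eq, Pi.zero_apply,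
      zero_apply, map_zero, add_zero] at e1
  simp only [coordCovDerivEnd, map_sub, map_add, sub_apply,
    add_apply, hlow hG0]
  linarith

/-- The Christoffel terms subtracted here are added back inside H. This grouping isolates the
ambient (∇B)(Df w, Df z), so that the other terms can be split into tangential and normal parts. -/
theorem fderiv_pullbackForm {B : E → E →L[ℝ] E →L[ℝ] ℝ} {f : F → E} {y : F}
    (hf : ContDiffAt ℝ ∞ f y) (hB : ContDiffAt ℝ ∞ B (f y)) (u w z : F) :
    fderiv ℝ (pullbackForm f B) y u w z =
      fderiv ℝ B (f y) (fderiv ℝ f y u) (fderiv ℝ f y w) (fderiv ℝ f y z)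
        - B (f y) (christoffel G (f y) (fderiv ℝ f y u) (fderiv ℝ f y w)) (fderiv ℝ f y z)
        - B (f y) (fderiv ℝ f y w) (christoffel G (f y) (fderiv ℝ f y u) (fderiv ℝ f y z))
        + B (f y) (covHessian G f y u w) (fderiv ℝ f y z)
        + B (f y) (fderiv ℝ f y w) (covHessian G f y u z) := by
  rw [← fderiv_apply_apply ((contDiffAt_pullbackForm hf hB).differentiableAt (by simp))]
  simp only [pullbackForm_apply]
  rw [fderiv_form_along (hB.differentiableAt (by simp)) (hf.differentiableAt (by simp))
    (differentiableAt_fderiv_apply hf w) (differentiableAt_fderiv_apply hf z)]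
  simp only [covHessian, covAlong, map_add, add_apply]
  ring

end Coordinates

/-! ### Connection and curvature depend only on germs of the coefficients. -/

section Germs

variable {E : Type*} [NormedAddCommGroup E] [NormedSpace ℝ E]
  {G G' : E → E →L[ℝ] E →L[ℝ] ℝ} {A A' : E → E →L[ℝ] E} {p : E}

theorem christoffel_congr (h : G =ᶠ[𝓝 p] G') (u v : E) :
    christoffel G p u v = christoffel G' p u v := by
  unfold christoffel
  rw [h.eq_of_nhds, h.fderiv_eq]

theorem coordCurvature_congr (h : G =ᶠ[𝓝 p] G') (u v w : E) :
    coordCurvature G p u v w = coordCurvature G' p u v w := by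
  have hc (a b : E) : (fun z => christoffel G z a b) =ᶠ[𝓝 p] fun z => christoffel G' z a b :=
    h.eventuallyEq_nhds.mono fun z hz => christoffel_congr hz a b
  simp only [coordCurvature, (hc _ _).fderiv_eq, christoffel_congr h]

theorem coordCovDerivEnd_congr (h : G =ᶠ[𝓝 p] G') (hA : A =ᶠ[𝓝 p] A') (u w : E) :
    coordCovDerivEnd G A p u w = coordCovDerivEnd G' A' p u w := by
  have hc : (fun z => A z w) =ᶠ[𝓝 p] fun z => A' z w := hA.mono fun z hz =>
    congrArg (fun T : E →L[ℝ] E => T w) hz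
  simp only [coordCovDerivEnd, hc.fderiv_eq, christoffel_congr h, hA.eq_of_nhds]

end Germs

/-! ### Passage between tensor fields and their coordinate expressions. -/

section Charts

variable {E : Type*} [NormedAddCommGroup E] [NormedSpace ℝ E]
  {M : Type*} [TopologicalSpace M] [ChartedSpace E M] [IsManifold 𝓘(ℝ, E) ∞ M]

theorem chartDeriv_comp_chartSymmDeriv {c : M} {y : E} (hy : y ∈ (extChartAt 𝓘(ℝ, E) c).target) :
    chartDeriv c y ∘L chartSymmDeriv c y = ContinuousLinearMap.id ℝ E := by
  have : IsManifold 𝓘(ℝ, E) 1 M := .of_le (n := ∞) (by simp)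
  have h := mfderiv_extChartAt_comp_mfderivWithin_extChartAt_symm (I := 𝓘(ℝ, E)) hy
  rw [ModelWithCorners.Boundaryless.range_eq_univ, mfderivWithin_univ] at h
  exact h

theorem chartSymmDeriv_comp_chartDeriv {c : M} {y : E} (hy : y ∈ (extChartAt 𝓘(ℝ, E) c).target) :
    chartSymmDeriv c y ∘L chartDeriv c y = ContinuousLinearMap.id ℝ _ := by
  have : IsManifold 𝓘(ℝ, E) 1 M := .of_le (n := ∞) (by simp)
  have h := mfderivWithin_extChartAt_symm_comp_mfderiv_extChartAt (I := 𝓘(ℝ, E)) hy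
  rw [ModelWithCorners.Boundaryless.range_eq_univ, mfderivWithin_univ] at h
  exact h

theorem chartSymmDeriv_injective {c : M} {y : E} (hy : y ∈ (extChartAt 𝓘(ℝ, E) c).target) :
    Function.Injective (chartSymmDeriv c y) :=
  Function.LeftInverse.injective (g := chartDeriv c y)
    fun u => DFunLike.congr_fun (chartDeriv_comp_chartSymmDeriv hy) u

/-- The tangent space at `x` is identified with `E` by the preferred chart at `x`, so at the base
point tensors equal their coordinate expressions, with no Jacobian. -/
theorem chartSymmDeriv_self (x : M) :
    chartSymmDeriv x (extChartAt 𝓘(ℝ, E) x x) = ContinuousLinearMap.id ℝ E := by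
  have : IsManifold 𝓘(ℝ, E) 1 M := .of_le (n := ∞) (by simp)
  have h := mfderivWithin_range_extChartAt_symm (I := 𝓘(ℝ, E)) (x := x)
  rw [ModelWithCorners.Boundaryless.range_eq_univ, mfderivWithin_univ] at h
  exact h

-- All tangent spaces are the model space, so vectors at propositionally equal points are compared
-- in `E`, without transport.
omit [IsManifold 𝓘(ℝ, E) ∞ M] in
theorem BilinField.congr_point (B : BilinField E M) {p q : M} (h : p = q)
    {u v : TangentSpace 𝓘(ℝ, E) p} {u' v' : TangentSpace 𝓘(ℝ, E) q}
    (hu : (show E from u) = u') (hv : (show E from v) = v') : B p u v = B q u' v' := by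
  subst h
  cases hu
  cases hv
  rfl

omit [IsManifold 𝓘(ℝ, E) ∞ M] in
theorem BilinField.inChart_apply (B : BilinField E M) (c : M) (y u v : E) :
    B.inChart c y u v =
      B ((extChartAt 𝓘(ℝ, E) c).symm y) (chartSymmDeriv c y u) (chartSymmDeriv c y v) := rfl

theorem BilinField.inChart_self (B : BilinField E M) (x : M) (u v : TangentSpace 𝓘(ℝ, E) x) :
    B.inChart x (extChartAt 𝓘(ℝ, E) x x) u v = B x u v := by
  exact B.congr_point (extChartAt_to_inv x) (DFunLike.congr_fun (chartSymmDeriv_self (E := E) x) u)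
    (DFunLike.congr_fun (chartSymmDeriv_self (E := E) x) v)

theorem BilinField.inChart_self_eq (B : BilinField E M) (x : M) :
    B.inChart x (extChartAt 𝓘(ℝ, E) x x) = B x := by
  ext u v
  exact B.inChart_self x u v

/-- Smoothness of a field of bilinear forms. -/
def BilinField.IsSmooth (B : BilinField E M) : Prop :=
  ContMDiff 𝓘(ℝ, E) (𝓘(ℝ, E).prod 𝓘(ℝ, E →L[ℝ] E →L[ℝ] ℝ)) ∞
    (fun x : M => Bundle.TotalSpace.mk' (E →L[ℝ] E →L[ℝ] ℝ)
      (E := fun x : M => TangentSpace 𝓘(ℝ, E) x →L[ℝ] TangentSpace 𝓘(ℝ, E) x →L[ℝ] ℝ)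
      x (B x))

theorem contMDiffAt_chartSymmDeriv {c : M} {y : E} (hy : y ∈ (extChartAt 𝓘(ℝ, E) c).target)
    (u : E) : ContMDiffAt 𝓘(ℝ, E) (𝓘(ℝ, E).prod 𝓘(ℝ, E)) ∞
      (fun z => Bundle.TotalSpace.mk' E (E := fun x : M => TangentSpace 𝓘(ℝ, E) x)
        ((extChartAt 𝓘(ℝ, E) c).symm z) (chartSymmDeriv c z u)) y := by
  have : IsManifold 𝓘(ℝ, E) 1 M := .of_le (n := ∞) (by simp)
  have hsrc {z : E} (hz : z ∈ (extChartAt 𝓘(ℝ, E) c).target) :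
      (extChartAt 𝓘(ℝ, E) c).symm z ∈ (chartAt E c).source := by
    rw [← extChartAt_source 𝓘(ℝ, E)]
    exact (extChartAt 𝓘(ℝ, E) c).map_target hz
  rw [(trivializationAt E (TangentSpace 𝓘(ℝ, E)) c).contMDiffAt_iff (by
    rw [Bundle.Trivialization.mem_source]; exact hsrc hy)]
  refine ⟨(contMDiffOn_extChartAt_symm c).contMDiffAt (extChartAt_target_mem_nhds' hy), ?_⟩
  -- The trivialization at `c` is the differential of the chart, so it sends the coordinate field to
  -- the constant `u`.
  refine (contMDiffAt_const (c := u)).congr_of_eventuallyEq ?_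
  filter_upwards [extChartAt_target_mem_nhds' hy] with z hz
  have h1 := TangentBundle.continuousLinearMapAt_trivializationAt (I := 𝓘(ℝ, E)) (hsrc hz)
  have h2 := DFunLike.congr_fun (chartDeriv_comp_chartSymmDeriv hz) u
  have h3 := DFunLike.congr_fun h1 (chartSymmDeriv c z u)
  rw [Bundle.Trivialization.continuousLinearMapAt_apply,
    Bundle.Trivialization.linearMapAt_apply] at h3
  exact ((if_pos (hsrc hz)).symm.trans h3).trans h2

theorem BilinField.IsSmooth.contDiffAt_inChart [FiniteDimensional ℝ E] {B : BilinField E M}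
    (hB : B.IsSmooth) {c : M} {y : E} (hy : y ∈ (extChartAt 𝓘(ℝ, E) c).target) :
    ContDiffAt ℝ ∞ (B.inChart c) y := by
  have happ (u v : E) : ContDiffOn ℝ ∞ (fun z => B.inChart c z u v)
      (extChartAt 𝓘(ℝ, E) c).target := by
    intro y hy
    have hsymm : ContMDiffAt 𝓘(ℝ, E) 𝓘(ℝ, E) ∞ (extChartAt 𝓘(ℝ, E) c).symm y :=
      (contMDiffOn_extChartAt_symm c).contMDiffAt (extChartAt_target_mem_nhds' hy)
    have : ContMDiffAt 𝓘(ℝ, E) (𝓘(ℝ, E).prod 𝓘(ℝ, ℝ)) ∞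
        (fun z => Bundle.TotalSpace.mk' ℝ (E := Bundle.Trivial M ℝ)
          ((extChartAt 𝓘(ℝ, E) c).symm z)
          (B ((extChartAt 𝓘(ℝ, E) c).symm z) (chartSymmDeriv c z u) (chartSymmDeriv c z v))) y := by
      apply ContMDiffAt.clm_bundle_apply₂ (F₁ := E) (F₂ := E)
      · exact ContMDiffAt.comp y hB.contMDiffAt hsymm
      · exact contMDiffAt_chartSymmDeriv hy u
      · exact contMDiffAt_chartSymmDeriv hy v
    rw [Bundle.contMDiffAt_totalSpace] at this
    exact this.2.contDiffAt.contDiffWithinAt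
  exact (contDiffOn_clm_apply.2 fun u => contDiffOn_clm_apply.2 fun v => happ u v).contDiffAt
    (extChartAt_target_mem_nhds' hy)

/-- Pointwise positive definiteness of a field of bilinear forms. -/
def BilinField.IsPos (g : BilinField E M) : Prop :=
  ∀ (x : M) (u : TangentSpace 𝓘(ℝ, E) x), u ≠ 0 → 0 < g x u u

omit [IsManifold 𝓘(ℝ, E) ∞ M] in
theorem lorentz_apply [FiniteDimensional ℝ E] {g σ : BilinField E M} (hg : g.IsPos) (x : M)
    (v w : TangentSpace 𝓘(ℝ, E) x) : g x (lorentz g σ x v) w = σ x v w :=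
  DFunLike.congr_fun ((isInvertible_of_pos (E := E) (hg x)).self_apply_inverse (σ x v)) w

theorem BilinField.IsPos.inChart {g : BilinField E M} (hg : g.IsPos) {c : M} {y : E}
    (hy : y ∈ (extChartAt 𝓘(ℝ, E) c).target) (u : E) (hu : u ≠ 0) : 0 < g.inChart c y u u :=
  hg _ _ fun h0 => hu (chartSymmDeriv_injective hy (h0.trans (map_zero _).symm))

/-- Both sides represent the coordinate form of σ against a positive definite form, hence agree.
Being valid on the whole chart target, the identity can be differentiated. -/
theorem lorentz_inChart [FiniteDimensional ℝ E] {g σ : BilinField E M} (hg : g.IsPos) {c : M}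
    {y : E} (hy : y ∈ (extChartAt 𝓘(ℝ, E) c).target) :
    EndField.inChart (lorentz g σ) c y = (g.inChart c y).inverse ∘L σ.inChart c y := by
  have hpos := hg.inChart hy
  ext u
  refine eq_of_forall_apply_eq hpos fun w => ?_
  rw [ContinuousLinearMap.comp_apply, (isInvertible_of_pos hpos).self_apply_inverse]
  have h1 : chartSymmDeriv c y (EndField.inChart (lorentz g σ) c y u) =
      lorentz g σ _ (chartSymmDeriv c y u) :=
    DFunLike.congr_fun (chartSymmDeriv_comp_chartDeriv hy) _
  rw [BilinField.inChart_apply, h1, lorentz_apply hg, BilinField.inChart_apply]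

theorem isMetricAt_inChart [FiniteDimensional ℝ E] {g : BilinField E M} (hs : g.IsSmooth)
    (hsymm : ∀ x u v, g x u v = g x v u) (hg : g.IsPos) {c : M} {y : E}
    (hy : y ∈ (extChartAt 𝓘(ℝ, E) c).target) : IsMetricAt (g.inChart c) y where
  contDiffAt := hs.contDiffAt_inChart hy
  symm _ _ := hsymm _ _ _
  pos := hg.inChart hy

end Charts

/-! ### Coordinate expression of an immersion. -/

section Immersions

variable {E : Type*} [NormedAddCommGroup E] [NormedSpace ℝ E]
  {M : Type*} [TopologicalSpace M] [ChartedSpace E M] [IsManifold 𝓘(ℝ, E) ∞ M]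
  {F : Type*} [NormedAddCommGroup F] [NormedSpace ℝ F]
  {N : Type*} [TopologicalSpace N] [ChartedSpace F N] [IsManifold 𝓘(ℝ, F) ∞ N]
  {ι : N → M} {x : N} {y : F}

/-- `y` lies in the domain of the coordinate expression of `ι`. -/
def MemChartDomain (ι : N → M) (x : N) (y : F) : Prop :=
  y ∈ (extChartAt 𝓘(ℝ, F) x).target ∧
    ι ((extChartAt 𝓘(ℝ, F) x).symm y) ∈ (extChartAt 𝓘(ℝ, E) (ι x)).source

omit [IsManifold 𝓘(ℝ, E) ∞ M] [IsManifold 𝓘(ℝ, F) ∞ N] in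
theorem memChartDomain_self (ι : N → M) (x : N) :
    MemChartDomain (E := E) ι x (extChartAt 𝓘(ℝ, F) x x) := by
  refine ⟨mem_extChartAt_target x, ?_⟩
  rw [extChartAt_to_inv]
  exact mem_extChartAt_source (ι x)

omit [IsManifold 𝓘(ℝ, E) ∞ M] [IsManifold 𝓘(ℝ, F) ∞ N] in
theorem MemChartDomain.eventually (hι : Continuous ι) (hy : MemChartDomain (E := E) ι x y) :
    ∀ᶠ z in 𝓝 y, MemChartDomain (E := E) ι x z := by
  have hc : ContinuousAt (fun z => ι ((extChartAt 𝓘(ℝ, F) x).symm z)) y :=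
    hι.continuousAt.comp ((continuousOn_extChartAt_symm x).continuousAt
      (extChartAt_target_mem_nhds' hy.1))
  exact Filter.Eventually.and (extChartAt_target_mem_nhds' hy.1)
    (hc.eventually ((isOpen_extChartAt_source (ι x)).mem_nhds hy.2))

theorem contDiffAt_writtenInExtChartAt (hι : ContMDiff 𝓘(ℝ, F) 𝓘(ℝ, E) ∞ ι)
    (hy : MemChartDomain (E := E) ι x y) :
    ContDiffAt ℝ ∞ (writtenInExtChartAt 𝓘(ℝ, F) 𝓘(ℝ, E) x ι) y := by
  have h1 : ContMDiffAt 𝓘(ℝ, F) 𝓘(ℝ, F) ∞ (extChartAt 𝓘(ℝ, F) x).symm y :=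
    (contMDiffOn_extChartAt_symm x).contMDiffAt (extChartAt_target_mem_nhds' hy.1)
  have h2 := hy.2
  rw [extChartAt_source] at h2
  have h3 : ContMDiffAt 𝓘(ℝ, E) 𝓘(ℝ, E) ∞ (extChartAt 𝓘(ℝ, E) (ι x))
    (ι ((extChartAt 𝓘(ℝ, F) x).symm y)) := contMDiffAt_extChartAt' h2
  exact (ContMDiffAt.comp y h3 (ContMDiffAt.comp y hι.contMDiffAt h1)).contDiffAt

/-- Near `y`, the inverse chart of `M` after the coordinate expression equals `ι` after the inverse
chart of `N`; apply the chain rule to both. -/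
theorem chartSymmDeriv_fderiv_writtenInExtChartAt (hι : ContMDiff 𝓘(ℝ, F) 𝓘(ℝ, E) ∞ ι)
    (hy : MemChartDomain (E := E) ι x y) (u : F) :
    (show E from chartSymmDeriv (ι x) (writtenInExtChartAt 𝓘(ℝ, F) 𝓘(ℝ, E) x ι y)
        (fderiv ℝ (writtenInExtChartAt 𝓘(ℝ, F) 𝓘(ℝ, E) x ι) y u)) =
      differential (E := E) ι ((extChartAt 𝓘(ℝ, F) x).symm y) (chartSymmDeriv x y u) := by
  have hN : MDifferentiableAt 𝓘(ℝ, F) 𝓘(ℝ, F) (extChartAt 𝓘(ℝ, F) x).symm y :=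
    ((contMDiffOn_extChartAt_symm (n := ∞) x).contMDiffAt
      (extChartAt_target_mem_nhds' hy.1)).mdifferentiableAt (by simp)
  have hM : MDifferentiableAt 𝓘(ℝ, E) 𝓘(ℝ, E) (extChartAt 𝓘(ℝ, E) (ι x)).symm
      (writtenInExtChartAt 𝓘(ℝ, F) 𝓘(ℝ, E) x ι y) :=
    ((contMDiffOn_extChartAt_symm (n := ∞) (ι x)).contMDiffAt
      (extChartAt_target_mem_nhds' ((extChartAt 𝓘(ℝ, E) (ι x)).map_source hy.2))).mdifferentiableAt
      (by simp)
  have hf := ((contDiffAt_writtenInExtChartAt hι hy).differentiableAt (by simp)).mdifferentiableAt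
  have e1 := mfderiv_comp y hM hf
  have e2 := mfderiv_comp y (hι.mdifferentiable (by simp) _) hN
  have e3 : (extChartAt 𝓘(ℝ, E) (ι x)).symm ∘ writtenInExtChartAt 𝓘(ℝ, F) 𝓘(ℝ, E) x ι =ᶠ[𝓝 y]
      ι ∘ (extChartAt 𝓘(ℝ, F) x).symm :=
    (hy.eventually hι.continuous).mono fun z hz => (extChartAt 𝓘(ℝ, E) (ι x)).left_inv hz.2
  have e4 := e3.mfderiv_eq (I := 𝓘(ℝ, F)) (I' := 𝓘(ℝ, E))
  rw [mfderiv_eq_fderiv] at e1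
  exact DFunLike.congr_fun (e1.symm.trans (e4.trans e2)) u

theorem isImmersedAt_writtenInExtChartAt (hι : ContMDiff 𝓘(ℝ, F) 𝓘(ℝ, E) ∞ ι)
    (hinj : ∀ x : N, Function.Injective (mfderiv 𝓘(ℝ, F) 𝓘(ℝ, E) ι x))
    (hy : MemChartDomain (E := E) ι x y) :
    IsImmersedAt (writtenInExtChartAt 𝓘(ℝ, F) 𝓘(ℝ, E) x ι) y where
  contDiffAt := contDiffAt_writtenInExtChartAt hι hy
  injective u v huv := by
    have hu := chartSymmDeriv_fderiv_writtenInExtChartAt hι hy u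
    have hv := chartSymmDeriv_fderiv_writtenInExtChartAt hι hy v
    rw [huv] at hu
    exact chartSymmDeriv_injective hy.1 (hinj _ (hu.symm.trans hv))

theorem induced_inChart (hι : ContMDiff 𝓘(ℝ, F) 𝓘(ℝ, E) ∞ ι) (B : BilinField E M)
    (hy : MemChartDomain (E := E) ι x y) :
    (induced (F := F) ι B).inChart x y =
      pullbackForm (writtenInExtChartAt 𝓘(ℝ, F) 𝓘(ℝ, E) x ι) (B.inChart (ι x)) y := by
  ext u v
  exact (B.congr_point ((extChartAt 𝓘(ℝ, E) (ι x)).left_inv hy.2)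
    (chartSymmDeriv_fderiv_writtenInExtChartAt hι hy u)
    (chartSymmDeriv_fderiv_writtenInExtChartAt hι hy v)).symm

omit [IsManifold 𝓘(ℝ, E) ∞ M] [IsManifold 𝓘(ℝ, F) ∞ N] in
theorem fderiv_writtenInExtChartAt_self (hι : MDifferentiableAt 𝓘(ℝ, F) 𝓘(ℝ, E) ι x) :
    fderiv ℝ (writtenInExtChartAt 𝓘(ℝ, F) 𝓘(ℝ, E) x ι) (extChartAt 𝓘(ℝ, F) x x) =
      differential (E := E) ι x := by
  have h := hι.mfderiv
  rw [ModelWithCorners.Boundaryless.range_eq_univ, fderivWithin_univ] at h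
  exact h.symm

omit [IsManifold 𝓘(ℝ, E) ∞ M] [IsManifold 𝓘(ℝ, F) ∞ N] in
theorem writtenInExtChartAt_self (ι : N → M) (x : N) :
    writtenInExtChartAt 𝓘(ℝ, F) 𝓘(ℝ, E) x ι (extChartAt 𝓘(ℝ, F) x x) =
      extChartAt 𝓘(ℝ, E) (ι x) (ι x) := by
  simp [writtenInExtChartAt]

end Immersions

/-! ### Tangential and normal parts; comparison of curvature and ∇Y. -/

section Submanifold

variable {E : Type*} [NormedAddCommGroup E] [NormedSpace ℝ E]
  {M : Type*} [TopologicalSpace M] [ChartedSpace E M]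
  {F : Type*} [NormedAddCommGroup F] [NormedSpace ℝ F] [FiniteDimensional ℝ F]
  {N : Type*} [TopologicalSpace N] [ChartedSpace F N]
  {ι : N → M} {g σ : BilinField E M} {x : N}

omit [FiniteDimensional ℝ F] in
theorem induced_apply (ι : N → M) (B : BilinField E M) (x : N) (u v : TangentSpace 𝓘(ℝ, F) x) :
    induced ι B x u v = B (ι x) (differential ι x u) (differential ι x v) := rfl

omit [FiniteDimensional ℝ F] in
theorem BilinField.IsPos.induced (hg : g.IsPos)
    (hinj : ∀ x : N, Function.Injective (mfderiv 𝓘(ℝ, F) 𝓘(ℝ, E) ι x)) :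
    (induced (F := F) ι g).IsPos :=
  fun x _ hu => hg _ _ fun h0 => hu (hinj x (h0.trans (map_zero _).symm))

theorem induced_tangentPart (hH : (induced (F := F) ι g).IsPos)
    (z : TangentSpace 𝓘(ℝ, E) (ι x)) (u : TangentSpace 𝓘(ℝ, F) x) :
    induced ι g x (tangentPart ι g x z) u = g (ι x) z (differential ι x u) :=
  DFunLike.congr_fun ((isInvertible_of_pos (E := F) (hH x)).self_apply_inverse
    ((g (ι x) z) ∘L (differential ι x))) u

theorem metric_normalPart_differential (hH : (induced (F := F) ι g).IsPos)
    (z : TangentSpace 𝓘(ℝ, E) (ι x)) (u : TangentSpace 𝓘(ℝ, F) x) :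
    g (ι x) (normalPart (F := F) ι g x z) (differential ι x u) = 0 := by
  have h := induced_tangentPart hH z u
  rw [normalPart, map_sub, sub_apply, ← h]
  exact sub_self _

omit [FiniteDimensional ℝ F] in
theorem differential_tangentPart_add_normalPart (z : TangentSpace 𝓘(ℝ, E) (ι x)) :
    differential ι x (tangentPart (F := F) ι g x z) + normalPart (F := F) ι g x z = z :=
  add_sub_cancel _ _

theorem metric_eq_normalPart_add_tangentPart (hsymm : ∀ x u v, g x u v = g x v u)
    (hH : (induced (F := F) ι g).IsPos) (z z' : TangentSpace 𝓘(ℝ, E) (ι x)) :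
    g (ι x) z z' = g (ι x) (normalPart (F := F) ι g x z) (normalPart (F := F) ι g x z')
      + induced ι g x (tangentPart (F := F) ι g x z) (tangentPart ι g x z') := by
  have h1 := metric_normalPart_differential hH z (tangentPart ι g x z')
  have h2 := metric_normalPart_differential hH z' (tangentPart ι g x z)
  rw [hsymm] at h2
  conv_lhs => rw [← differential_tangentPart_add_normalPart (F := F) (g := g) z,
    ← differential_tangentPart_add_normalPart (F := F) (g := g) z']
  simp only [map_add, add_apply]
  rw [h1, h2, induced_apply]
  ring

theorem metric_normalPart_eq (hH : (induced (F := F) ι g).IsPos)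
    (z z' : TangentSpace 𝓘(ℝ, E) (ι x)) :
    g (ι x) (normalPart (F := F) ι g x z) z' =
      g (ι x) (normalPart (F := F) ι g x z) (normalPart (F := F) ι g x z') := by
  conv_lhs => rw [← differential_tangentPart_add_normalPart (F := F) (g := g) z']
  rw [map_add, metric_normalPart_differential hH, zero_add]

/-- Paired with tangent vectors, both sides give σ: the Lorentz force of `N` is the tangential part
of that of `M`. -/
theorem tangentPart_lorentz [FiniteDimensional ℝ E] (hg : g.IsPos)
    (hH : (induced (F := F) ι g).IsPos) (w : TangentSpace 𝓘(ℝ, F) x) :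
    tangentPart ι g x (lorentz g σ (ι x) (differential ι x w)) =
      lorentz (induced ι g) (induced ι σ) x w := by
  refine eq_of_forall_apply_eq (E := F) (hH x) fun u => ?_
  exact (induced_tangentPart hH _ u).trans
    ((lorentz_apply hg _ _ _).trans (lorentz_apply (σ := induced ι σ) hH x w u).symm)

variable [FiniteDimensional ℝ E] [IsManifold 𝓘(ℝ, E) ∞ M] [IsManifold 𝓘(ℝ, F) ∞ N]

omit [FiniteDimensional ℝ F] [FiniteDimensional ℝ E] [IsManifold 𝓘(ℝ, E) ∞ M]
  [IsManifold 𝓘(ℝ, F) ∞ N] in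
theorem ambientCovDeriv_eq_covHessian (hι : MDifferentiableAt 𝓘(ℝ, F) 𝓘(ℝ, E) ι x) (v w : F) :
    ambientCovDeriv (F := F) ι g x v w = covHessian (g.inChart (ι x))
      (writtenInExtChartAt 𝓘(ℝ, F) 𝓘(ℝ, E) x ι) (extChartAt 𝓘(ℝ, F) x x) v w := by
  unfold ambientCovDeriv covHessian covAlong
  beta_reduce
  rw [fderiv_writtenInExtChartAt_self hι, writtenInExtChartAt_self]
  rfl

/-- `ι` is a smooth immersion, and `g` is a smooth Riemannian metric on its target. -/
structure IsRiemannianImmersion (F : Type*) [NormedAddCommGroup F] [NormedSpace ℝ F]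
    [ChartedSpace F N] (ι : N → M) (g : BilinField E M) : Prop where
  contMDiff : ContMDiff 𝓘(ℝ, F) 𝓘(ℝ, E) ∞ ι
  injective : ∀ x : N, Function.Injective (mfderiv 𝓘(ℝ, F) 𝓘(ℝ, E) ι x)
  smooth : g.IsSmooth
  symm : ∀ x u v, g x u v = g x v u
  pos : g.IsPos

omit [FiniteDimensional ℝ F] [IsManifold 𝓘(ℝ, F) ∞ N] in
theorem IsRiemannianImmersion.eventually_metric (h : IsRiemannianImmersion F ι g) (x : N) :
    ∀ᶠ z in 𝓝 (writtenInExtChartAt 𝓘(ℝ, F) 𝓘(ℝ, E) x ι (extChartAt 𝓘(ℝ, F) x x)),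
      IsMetricAt (g.inChart (ι x)) z := by
  rw [writtenInExtChartAt_self]
  exact Filter.mem_of_superset (extChartAt_target_mem_nhds (ι x)) fun z hz =>
    isMetricAt_inChart h.smooth h.symm h.pos hz

omit [FiniteDimensional ℝ E] [FiniteDimensional ℝ F] in
theorem IsRiemannianImmersion.eventually_immersed (h : IsRiemannianImmersion F ι g) (x : N) :
    ∀ᶠ z in 𝓝 (extChartAt 𝓘(ℝ, F) x x),
      IsImmersedAt (writtenInExtChartAt 𝓘(ℝ, F) 𝓘(ℝ, E) x ι) z :=
  ((memChartDomain_self ι x).eventually h.contMDiff.continuous).mono fun _ hz =>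
    isImmersedAt_writtenInExtChartAt h.contMDiff h.injective hz

omit [FiniteDimensional ℝ E] [FiniteDimensional ℝ F] in
theorem pullbackForm_eventuallyEq (hι : ContMDiff 𝓘(ℝ, F) 𝓘(ℝ, E) ∞ ι) (B : BilinField E M)
    (x : N) : pullbackForm (writtenInExtChartAt 𝓘(ℝ, F) 𝓘(ℝ, E) x ι) (B.inChart (ι x))
      =ᶠ[𝓝 (extChartAt 𝓘(ℝ, F) x x)] (induced (F := F) ι B).inChart x :=
  ((memChartDomain_self ι x).eventually hι.continuous).mono fun _ hz =>
    (induced_inChart hι B hz).symm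

theorem tangentPart_ambientCovDeriv (h : IsRiemannianImmersion F ι g) (v w : F) :
    tangentPart ι g x (ambientCovDeriv (F := F) ι g x v w) =
      christoffel ((induced (F := F) ι g).inChart x) (extChartAt 𝓘(ℝ, F) x x) v w := by
  have hH := h.pos.induced h.injective
  have hd := (h.contMDiff.mdifferentiable (by simp)) x
  refine eq_of_forall_apply_eq (E := F) (hH x) fun u => ?_
  have e := pullback_christoffel (h.eventually_immersed x).self_of_nhds (h.eventually_metric x)
    v w u
  rw [christoffel_congr (pullbackForm_eventuallyEq h.contMDiff g x),
    (pullbackForm_eventuallyEq h.contMDiff g x).eq_of_nhds, ← ambientCovDeriv_eq_covHessian hd,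
    fderiv_writtenInExtChartAt_self hd, writtenInExtChartAt_self, BilinField.inChart_self_eq,
    BilinField.inChart_self_eq] at e
  exact (induced_tangentPart hH _ u).trans e.symm

/-- The Gauss equation. -/
theorem gauss_equation (h : IsRiemannianImmersion F ι g) (u v w z : F) :
    g (ι x) (curvature g (ι x) (differential ι x u) (differential ι x v) (differential ι x w))
        (differential ι x z) =
      induced ι g x (curvature (induced ι g) x u v w) z
        - g (ι x) (secondFundForm ι g x v w) (secondFundForm ι g x u z)
        + g (ι x) (secondFundForm ι g x u w) (secondFundForm ι g x v z) := by
  have hH := h.pos.induced h.injective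
  have hd := (h.contMDiff.mdifferentiable (by simp)) x
  have he := pullbackForm_eventuallyEq h.contMDiff g x
  have e := coord_gauss (h.eventually_immersed x) (h.eventually_metric x) u v w z
  simp only [christoffel_congr he] at e
  rw [coordCurvature_congr he, he.eq_of_nhds] at e
  simp only [← ambientCovDeriv_eq_covHessian hd, fderiv_writtenInExtChartAt_self hd,
    writtenInExtChartAt_self, BilinField.inChart_self_eq,
    ← tangentPart_ambientCovDeriv h] at e
  have s1 := metric_eq_normalPart_add_tangentPart h.symm hH
    (ambientCovDeriv ι g x v w) (ambientCovDeriv ι g x u z)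
  have s2 := metric_eq_normalPart_add_tangentPart h.symm hH
    (ambientCovDeriv ι g x u w) (ambientCovDeriv ι g x v z)
  -- Each ambient product `m` is a tangential product `c` plus a normal one `c'`; the tangential
  -- ones cancel and the normal ones are the II terms.
  have arith {a b c d c' d' m m' : ℝ} (e : a = b + (c - m) - (d - m')) (s1 : m = c' + c)
      (s2 : m' = d' + d) : a = b - c' + d' := by linarith
  exact arith e s1 s2

theorem metric_covDerivEnd_lorentz_eq (hs : g.IsSmooth) (hsymm : ∀ x u v, g x u v = g x v u)
    (hg : g.IsPos) (hσ : σ.IsSmooth) (p : M) (u w z : E) :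
    g p (covDerivEnd g (lorentz g σ) p u w) z =
      fderiv ℝ (σ.inChart p) (extChartAt 𝓘(ℝ, E) p p) u w z
        - σ p (christoffel (E := E) (g.inChart p) (extChartAt 𝓘(ℝ, E) p p) u w) z
        - σ p w (christoffel (E := E) (g.inChart p) (extChartAt 𝓘(ℝ, E) p p) u z) := by
  have hm : ∀ᶠ y in 𝓝 (extChartAt 𝓘(ℝ, E) p p), IsMetricAt (g.inChart p) y :=
    Filter.mem_of_superset (extChartAt_target_mem_nhds p) fun y hy =>
      isMetricAt_inChart hs hsymm hg hy
  have hY : (EndField.inChart (lorentz g σ) p) =ᶠ[𝓝 (extChartAt 𝓘(ℝ, E) p p)]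
      fun q => (g.inChart p q).inverse ∘L σ.inChart p q :=
    Filter.mem_of_superset (extChartAt_target_mem_nhds p) fun y hy => lorentz_inChart hg hy
  have e := metric_coordCovDerivEnd_lorentz hm
    (hσ.contDiffAt_inChart (mem_extChartAt_target p)) u w z
  rw [← coordCovDerivEnd_congr Filter.EventuallyEq.rfl hY, BilinField.inChart_self_eq,
    BilinField.inChart_self_eq] at e
  exact e

theorem metric_covDerivEnd_lorentz_induced_eq (h : IsRiemannianImmersion F ι g) (hσ : σ.IsSmooth)
    (u w z : F) :
    induced ι g x (covDerivEnd (induced ι g) (lorentz (induced ι g) (induced ι σ)) x u w) z =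
      fderiv ℝ ((induced ι σ).inChart x) (extChartAt 𝓘(ℝ, F) x x) u w z
        - induced ι σ x (tangentPart ι g x (ambientCovDeriv (F := F) ι g x u w)) z
        - induced ι σ x w (tangentPart ι g x (ambientCovDeriv (F := F) ι g x u z)) := by
  have hH := h.pos.induced h.injective
  have he := pullbackForm_eventuallyEq h.contMDiff g x
  have heσ := pullbackForm_eventuallyEq h.contMDiff σ x
  have him := h.eventually_immersed x
  have hm : ∀ᶠ y in 𝓝 (extChartAt 𝓘(ℝ, F) x x), IsMetricAt
      (pullbackForm (writtenInExtChartAt 𝓘(ℝ, F) 𝓘(ℝ, E) x ι) (g.inChart (ι x))) y := by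
    filter_upwards [him, him.self_of_nhds.contDiffAt.continuousAt.eventually
      (h.eventually_metric x)] with y h1 h2 using h2.pullback h1
  have hY : (EndField.inChart (lorentz (induced ι g) (induced ι σ)) x)
      =ᶠ[𝓝 (extChartAt 𝓘(ℝ, F) x x)]
      fun q => (pullbackForm (writtenInExtChartAt 𝓘(ℝ, F) 𝓘(ℝ, E) x ι) (g.inChart (ι x)) q).inverse
        ∘L pullbackForm (writtenInExtChartAt 𝓘(ℝ, F) 𝓘(ℝ, E) x ι) (σ.inChart (ι x)) q := by
    filter_upwards [extChartAt_target_mem_nhds x, he, heσ] with y hy h1 h2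
    rw [h1, h2]
    exact lorentz_inChart hH hy
  have hσ0 : ContDiffAt ℝ ∞ (σ.inChart (ι x))
      (writtenInExtChartAt 𝓘(ℝ, F) 𝓘(ℝ, E) x ι (extChartAt 𝓘(ℝ, F) x x)) := by
    rw [writtenInExtChartAt_self]
    exact hσ.contDiffAt_inChart (mem_extChartAt_target (ι x))
  have e := metric_coordCovDerivEnd_lorentz hm
    (contDiffAt_pullbackForm him.self_of_nhds.contDiffAt hσ0) u w z
  rw [← coordCovDerivEnd_congr he.symm hY, he.eq_of_nhds, heσ.eq_of_nhds, heσ.fderiv_eq,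
    christoffel_congr he, christoffel_congr he, ← tangentPart_ambientCovDeriv h,
    ← tangentPart_ambientCovDeriv h, BilinField.inChart_self_eq,
    BilinField.inChart_self_eq] at e
  exact e

omit [FiniteDimensional ℝ F] in
theorem fderiv_induced_inChart (h : IsRiemannianImmersion F ι g) (hσ : σ.IsSmooth) (u w z : F) :
    fderiv ℝ ((induced ι σ).inChart x) (extChartAt 𝓘(ℝ, F) x x) u w z =
      fderiv ℝ (σ.inChart (ι x)) (extChartAt 𝓘(ℝ, E) (ι x) (ι x))
          (differential (E := E) ι x u) (differential (E := E) ι x w) (differential (E := E) ι x z)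
        - σ (ι x) (christoffel (E := E) (g.inChart (ι x)) (extChartAt 𝓘(ℝ, E) (ι x) (ι x))
            (differential ι x u) (differential ι x w)) (differential ι x z)
        - σ (ι x) (differential ι x w) (christoffel (E := E) (g.inChart (ι x))
            (extChartAt 𝓘(ℝ, E) (ι x) (ι x)) (differential ι x u) (differential ι x z))
        + σ (ι x) (ambientCovDeriv (F := F) ι g x u w) (differential ι x z)
        + σ (ι x) (differential ι x w) (ambientCovDeriv (F := F) ι g x u z) := by
  have hd := (h.contMDiff.mdifferentiable (by simp)) x
  have hσ0 : ContDiffAt ℝ ∞ (σ.inChart (ι x))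
      (writtenInExtChartAt 𝓘(ℝ, F) 𝓘(ℝ, E) x ι (extChartAt 𝓘(ℝ, F) x x)) := by
    rw [writtenInExtChartAt_self]
    exact hσ.contDiffAt_inChart (mem_extChartAt_target (ι x))
  have e := fderiv_pullbackForm (G := g.inChart (ι x))
    (h.eventually_immersed x).self_of_nhds.contDiffAt hσ0 u w z
  rw [(pullbackForm_eventuallyEq h.contMDiff σ x).fderiv_eq,
    ← ambientCovDeriv_eq_covHessian hd, ← ambientCovDeriv_eq_covHessian hd,
    fderiv_writtenInExtChartAt_self hd, writtenInExtChartAt_self,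
    BilinField.inChart_self_eq] at e
  exact e

omit [IsManifold 𝓘(ℝ, F) ∞ N] in
/-- The normal part of the Lorentz force represents `σ` on pairs of normal and tangent vectors. -/
theorem form_normalPart_differential (h : IsRiemannianImmersion F ι g)
    (hskew : ∀ x u v, σ x u v = -σ x v u) (a : TangentSpace 𝓘(ℝ, E) (ι x))
    (z : TangentSpace 𝓘(ℝ, F) x) :
    σ (ι x) (normalPart (F := F) ι g x a) (differential ι x z) =
      -g (ι x) (normalPart (F := F) ι g x a) (normalLorentz ι g σ x z) := by
  rw [hskew, normalLorentz, ← metric_normalPart_eq (h.pos.induced h.injective),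
    h.symm _ _ (lorentz g σ (ι x) (differential ι x z)), lorentz_apply h.pos]

omit [IsManifold 𝓘(ℝ, F) ∞ N] in
theorem form_eq_tangentPart_sub (h : IsRiemannianImmersion F ι g)
    (hskew : ∀ x u v, σ x u v = -σ x v u) (a : TangentSpace 𝓘(ℝ, E) (ι x))
    (z : TangentSpace 𝓘(ℝ, F) x) :
    σ (ι x) a (differential ι x z) = induced ι σ x (tangentPart ι g x a) z
      - g (ι x) (normalPart (F := F) ι g x a) (normalLorentz ι g σ x z) := by
  conv_lhs => rw [← differential_tangentPart_add_normalPart (F := F) (g := g) a]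
  rw [map_add, add_apply, form_normalPart_differential h hskew, ← sub_eq_add_neg]
  rfl

/-- Both sides are ∇σ, written through the same derivative of the pulled-back form. In σ(∇_u w, z)
and σ(w, ∇_u z) the tangential parts of the derivatives are the terms of `N`; the normal parts give
the two pairings with Y^⊥, with opposite signs as σ is skew. -/
theorem metric_covDerivEnd_lorentz (h : IsRiemannianImmersion F ι g) (hσ : σ.IsSmooth)
    (hskew : ∀ x u v, σ x u v = -σ x v u) (u w z : F) :
    g (ι x) (covDerivEnd g (lorentz g σ) (ι x) (differential ι x u) (differential ι x w))
        (differential ι x z) =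
      induced ι g x (covDerivEnd (induced ι g) (lorentz (induced ι g) (induced ι σ)) x u w) z
        + g (ι x) (secondFundForm ι g x u w) (normalLorentz ι g σ x z)
        - g (ι x) (secondFundForm ι g x u z) (normalLorentz ι g σ x w) := by
  have e1 := metric_covDerivEnd_lorentz_eq h.smooth h.symm h.pos hσ (ι x)
    (differential (E := E) ι x u) (differential (E := E) ι x w) (differential (E := E) ι x z)
  have e2 := metric_covDerivEnd_lorentz_induced_eq (x := x) h hσ u w z
  have e3 := fderiv_induced_inChart (x := x) h hσ u w z
  have e4 := form_eq_tangentPart_sub h hskew (ambientCovDeriv (F := F) ι g x u w) z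
  have e5 := form_eq_tangentPart_sub h hskew (ambientCovDeriv (F := F) ι g x u z) w
  have e6 := hskew (ι x) (differential ι x w) (ambientCovDeriv (F := F) ι g x u z)
  have e7 := hskew (ι x) (differential ι x w)
    (differential ι x (tangentPart (F := F) ι g x (ambientCovDeriv (F := F) ι g x u z)))
  have arith {m d s1 s2 n dn t1 t2 c1 c2 n1 n2 c2' t2' : ℝ} (e1 : m = d - s1 - s2)
      (e2 : n = dn - t1 - t2) (e3 : dn = d - s1 - s2 + c1 + c2) (e4 : c1 = t1 - n1)
      (e5 : c2' = t2' - n2) (e6 : c2 = -c2') (e7 : t2 = -t2') : m = n + n1 - n2 := by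
    linarith
  exact arith e1 e2 e3 e4 e5 e6 e7

end Submanifold

/-! ### The magnetic sectional curvature of an orthonormal pair. -/

section MagneticSectionalCurvature

variable {E : Type*} [NormedAddCommGroup E] [NormedSpace ℝ E] [FiniteDimensional ℝ E]
  {M : Type*} [TopologicalSpace M] [ChartedSpace E M] {g σ : BilinField E M} {x : M}
  {v w : TangentSpace 𝓘(ℝ, E) x}

omit [FiniteDimensional ℝ E] in
theorem metric_projPerp (hvw : g x v w = 0) (z : TangentSpace 𝓘(ℝ, E) x) :
    g x (projPerp g x v z) w = g x z w := by
  rw [projPerp, projLine, map_sub, sub_apply, map_smul, smul_apply, hvw, smul_zero, sub_zero]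

theorem magSec_eq (hg : g.IsPos) (hskew : ∀ x u v, σ x u v = -σ x v u) (s : ℝ)
    (hv : g x v v = 1) (hvw : g x v w = 0) :
    magSec g σ s x v w = s ^ 2 * g x (curvature g x w v v) w
      - s * g x (covDerivEnd g (lorentz g σ) x w v) w
      + s / 2 * g x (covDerivEnd g (lorentz g σ) x v w) w
      + 3 / 4 * σ x v w ^ 2 + 1 / 4 * g x (lorentz g σ x w) (lorentz g σ x w) := by
  -- P_v(Yw) = σ(w,v) v, so the pairing is σ(w,v) σ(v,w).
  have h1 : g x (lorentz g σ x (projLine g x v (lorentz g σ x w))) w = -σ x v w ^ 2 := by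
    rw [lorentz_apply hg, projLine, map_smul, smul_apply, hv, lorentz_apply hg, hskew x w v]
    simp
    ring
  have h2 : g x (lorentz g σ x (lorentz g σ x w)) w = -g x (lorentz g σ x w) (lorentz g σ x w) := by
    rw [lorentz_apply hg, lorentz_apply hg, hskew]
  simp only [magSec, magCurvature, magR, magA, map_add, map_sub, map_neg, map_smul, add_apply,
    sub_apply, neg_apply, smul_apply, smul_eq_mul, metric_projPerp hvw, h1, h2]
  ring

end MagneticSectionalCurvature

end MagneticGeometry

end

/-! ### The magnetic Gauss equation. -/

theorem mainTheorem2
    {E : Type*} [NormedAddCommGroup E] [NormedSpace ℝ E] [FiniteDimensional ℝ E]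
    {M : Type*} [TopologicalSpace M] [ChartedSpace E M] [IsManifold 𝓘(ℝ, E) ∞ M]
    {F : Type*} [NormedAddCommGroup F] [NormedSpace ℝ F] [FiniteDimensional ℝ F]
    {N : Type*} [TopologicalSpace N] [ChartedSpace F N] [IsManifold 𝓘(ℝ, F) ∞ N]
    (S : MagneticGeometry.MagneticSystem E M)
    (ι : N → M) (hι : ContMDiff 𝓘(ℝ, F) 𝓘(ℝ, E) ∞ ι)
    (hι_inj : ∀ x : N, Function.Injective (mfderiv 𝓘(ℝ, F) 𝓘(ℝ, E) ι x))
    (s : ℝ) (hs : 0 < s) (x : N) (v w : TangentSpace 𝓘(ℝ, F) x)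
    (hv : MagneticGeometry.induced ι S.metric.inner x v v = 1)
    (hw : MagneticGeometry.induced ι S.metric.inner x w w = 1)
    (hvw : MagneticGeometry.induced ι S.metric.inner x v w = 0) :
    MagneticGeometry.magSec S.metric.inner S.form s (ι x)
        (MagneticGeometry.differential ι x v) (MagneticGeometry.differential ι x w) =
      MagneticGeometry.magSec (MagneticGeometry.induced (F := F) ι S.metric.inner)
          (MagneticGeometry.induced (F := F) ι S.form) s x v w
        - S.metric.inner (ι x)
            (MagneticGeometry.magSecondFundForm ι S.metric.inner S.form s x v v)
            (MagneticGeometry.secondFundForm ι S.metric.inner x w w)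
        + S.metric.inner (ι x)
            (MagneticGeometry.secondFundForm ι S.metric.inner x v w)
            (MagneticGeometry.magSecondFundForm ι S.metric.inner S.form s x v w)
        + (1 / 4) * S.metric.inner (ι x)
            (MagneticGeometry.normalLorentz ι S.metric.inner S.form x w)
            (MagneticGeometry.normalLorentz ι S.metric.inner S.form x w) := by
  open MagneticGeometry in
  have h : IsRiemannianImmersion F ι S.metric.inner :=
    ⟨hι, hι_inj, S.metric.contMDiff, S.metric.symm, S.metric.pos⟩
  have hH := h.pos.induced hι_inj
  have hskew (y : M) (a b : TangentSpace 𝓘(ℝ, E) y) : S.form y a b = -S.form y b a := by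
    have e := S.form_self y (a + b)
    simp only [map_add, add_apply, S.form_self] at e
    linarith
  have hσ : BilinField.IsSmooth S.form := S.form_contMDiff
  -- The comparison formulas produce II(w,v). Symmetry already holds before projecting, since H is
  -- symmetric.
  have hII : secondFundForm ι S.metric.inner x w v = secondFundForm ι S.metric.inner x v w := by
    unfold secondFundForm
    congr 1
    have hd := (hι.mdifferentiable (by simp)) x
    exact (ambientCovDeriv_eq_covHessian hd w v).trans
      ((covHessian_symm (h.eventually_immersed x).self_of_nhds.contDiffAt
        (h.eventually_metric x) w v).trans (ambientCovDeriv_eq_covHessian hd v w).symm)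
  have e1 := magSec_eq (σ := S.form) (v := differential ι x v) (w := differential ι x w)
    h.pos hskew s hv hvw
  have e2 := magSec_eq (σ := induced ι S.form) hH (fun y a b => hskew _ _ _) s hv hvw
  have e3 := gauss_equation (x := x) h w v v w
  have e4 := metric_covDerivEnd_lorentz (x := x) h hσ hskew w v w
  -- With the last two arguments equal, the two normal corrections cancel.
  have e5 := metric_covDerivEnd_lorentz (x := x) h hσ hskew v w w
  have e6 := metric_eq_normalPart_add_tangentPart h.symm hH
    (lorentz S.metric.inner S.form (ι x) (differential ι x w))
    (lorentz S.metric.inner S.form (ι x) (differential ι x w))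
  rw [tangentPart_lorentz h.pos hH] at e6
  rw [e1, e2, e3, e4, e5, e6, hII]
  simp only [magSecondFundForm, map_sub, map_smul, sub_apply, smul_apply, smul_eq_mul,
    h.symm (ι x) (normalLorentz ι S.metric.inner S.form x v), induced_apply]
  unfold normalLorentz
  ring
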